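/- For a finite set $B\subset\mathbb{R}$ let $\mathbf{E}^+(B)$ be the number of quadruples $(a_1,a_2,b_1,b_2)\in B^4$ with $a_1+b_1=a_2+b_2$, and let $\mathbf{E}^\times(B)$ be the number of quadruples $(a_1,a_2,b_1,b_2)\in B^4$ with $a_1b_1=a_2b_2$. There are absolute constants $\kappa, C, c>0$ such that the following holds for every finite set $A\subset\mathbb{R}$ with $|A|\ge 2$. There is a set $A_1\subseteq A$ with $$|A_1|\ge \kappa\,\mathbf{E}^\times(A)^{1/3}\quad\text{and}\quad \mathbf{E}^+(A_1)\,\mathbf{E}^\times(A)\le C\,|A|^{11/2}(\log|A|)^c,$$ and there is a set $A_2\subseteq A$ with $$|A_2|\ge \kappa\,\mathbf{E}^+(A)^{1/3}\quad\text{and}\quad \mathbf{E}^\times(A_2)\,\mathbf{E}^+(A)\le C\,|A|^{11/2}(\log|A|)^c.$$ -/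

import Mathlib

/-!
Let `f` be one of the operations `+`, `*` and let `h` be the difference or quotient belonging to
the other one. Split the values of `f` on `A` into dyadic levels according to their number of
representations. If `E` is the energy of `f` on `A`, the elements `a` for which `f a c` has an
average share of the representations carry half of `E`. So, by the Cauchy–Schwarz inequality, they
form a set `S` with at least about `E ^ (1 / 3)` elements. They fall into logarithmically many
classes `B`, where `f a c` lies in one level `P` for many `c`.

The point `(b, f a c)` lies on a curve depending only on `c` and on the value `x = h a b`, since
`a * c = (x + b) * c` for `x = a - b` and `a + c = x * b + c` for `x = a / b`. If many values `x`
had many representations as `h a b` with `a ∈ B` and `b ∈ S`, then these curves would have too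
many incidences with the grid `S × P`, because they are monotone and two points determine the
curve. This bounds the energy of `h` between `B` and `S`, and summing over the classes bounds it
on `S`. Division by zero is avoided by removing `0` from `A`, which changes the energies by
`O(|A| ^ 2)` and a factor of `2`.
-/

section Energy

open Finset

variable {ι κ α β γ δ : Type*}

theorem exists_sum_le_card_mul {s : Finset ι} (hs : s.Nonempty) (u : ι → ℕ) :
    ∃ i ∈ s, ∑ j ∈ s, u j ≤ #s * u i :=
  exists_le_of_sum_le hs (by simp [mul_sum])

theorem exists_sum_pow_le_dyadic {s : Finset ι} (hs : s.Nonempty) {r : ι → ℕ} {J : ℕ}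
    (hr : ∀ i ∈ s, r i ≠ 0) (hJ : ∀ i ∈ s, r i < 2 ^ J) (k : ℕ) :
    ∃ j ∈ range J,
      ∑ i ∈ s, r i ^ k ≤ J * (#{i ∈ s | Nat.log 2 (r i) = j} * (2 ^ (j + 1)) ^ k) := by
  have hlog : ∀ i ∈ s, Nat.log 2 (r i) ∈ range J := fun i hi =>
    mem_range.2 (Nat.log_lt_of_lt_pow (hr i hi) (hJ i hi))
  obtain ⟨i, hi⟩ := hs
  obtain ⟨j, hj, hle⟩ := exists_sum_le_card_mul ⟨_, hlog i hi⟩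
    fun j => ∑ i ∈ s with Nat.log 2 (r i) = j, r i ^ k
  rw [sum_fiberwise_of_maps_to hlog, card_range] at hle
  refine ⟨j, hj, hle.trans (Nat.mul_le_mul_left _ (sum_le_card_nsmul _ _ _ fun i hi => ?_))⟩
  rw [← (mem_filter.1 hi).2]
  exact Nat.pow_le_pow_left (Nat.lt_pow_succ_log_self one_lt_two _).le k

theorem sum_le_two_mul_sum_filter_le_mul (s : Finset ι) (w : ι → ℕ) :
    ∑ i ∈ s, w i ≤ 2 * ∑ i ∈ s with ∑ j ∈ s, w j ≤ 2 * #s * w i, w i := by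
  obtain rfl | hs := s.eq_empty_or_nonempty
  · simp
  set M := ∑ j ∈ s, w j
  have hsplit := sum_filter_add_sum_filter_not s (fun i => M ≤ 2 * #s * w i) w
  have hlight : #s * (2 * ∑ i ∈ s with ¬ M ≤ 2 * #s * w i, w i) ≤ #s * M := by
    calc #s * (2 * ∑ i ∈ s with ¬ M ≤ 2 * #s * w i, w i)
        = ∑ i ∈ s with ¬ M ≤ 2 * #s * w i, 2 * #s * w i := by rw [← mul_sum]; ring
      _ ≤ #{i ∈ s | ¬ M ≤ 2 * #s * w i} • M :=
          sum_le_card_nsmul _ _ _ fun i hi => (not_le.1 (mem_filter.1 hi).2).le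
      _ ≤ #s * M := Nat.mul_le_mul_right _ (card_filter_le _ _)
  have := Nat.le_of_mul_le_mul_left hlight hs.card_pos
  omega

/-! ### Collisions -/

section Collisions

variable [DecidableEq γ]

/-- The number of ordered pairs of elements of `X` on which `φ` agrees, i.e. the second moment of
the fibre sizes of `φ` on `X`. Energies are collision numbers of binary operations. -/
def collisions (φ : ι → γ) (X : Finset ι) : ℕ := #{q ∈ X ×ˢ X | φ q.1 = φ q.2}

theorem card_filter_eq_eq_sum (φ : ι → γ) (ψ : κ → γ) (X : Finset ι) (Y : Finset κ) :
    #{q ∈ X ×ˢ Y | φ q.1 = ψ q.2} = ∑ i ∈ X, #{j ∈ Y | ψ j = φ i} := by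
  rw [card_filter, sum_product]
  simp only [card_filter, eq_comm]

theorem card_filter_eq_eq_sum_mul {φ : ι → γ} {X : Finset ι} {Z : Finset γ}
    (hZ : ∀ i ∈ X, φ i ∈ Z) (ψ : κ → γ) (Y : Finset κ) :
    #{q ∈ X ×ˢ Y | φ q.1 = ψ q.2} = ∑ z ∈ Z, #{i ∈ X | φ i = z} * #{j ∈ Y | ψ j = z} := by
  rw [card_filter_eq_eq_sum, ← sum_fiberwise_of_maps_to hZ]
  refine sum_congr rfl fun z _ => ?_
  rw [sum_congr rfl fun i hi => by rw [(mem_filter.1 hi).2], sum_const, smul_eq_mul]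

theorem collisions_eq_sum (φ : ι → γ) (X : Finset ι) :
    collisions φ X = ∑ i ∈ X, #{j ∈ X | φ j = φ i} :=
  card_filter_eq_eq_sum φ φ X X

theorem collisions_eq_sum_sq {φ : ι → γ} {X : Finset ι} {Z : Finset γ} (hZ : ∀ i ∈ X, φ i ∈ Z) :
    collisions φ X = ∑ z ∈ Z, #{i ∈ X | φ i = z} ^ 2 := by
  simp only [collisions, card_filter_eq_eq_sum_mul hZ, sq]

theorem card_filter_eq_sq_le (φ : ι → γ) (ψ : κ → γ) (X : Finset ι) (Y : Finset κ) :
    #{q ∈ X ×ˢ Y | φ q.1 = ψ q.2} ^ 2 ≤ collisions φ X * collisions ψ Y := by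
  have hX : ∀ i ∈ X, φ i ∈ X.image φ ∪ Y.image ψ := fun i hi =>
    mem_union_left _ (mem_image_of_mem _ hi)
  have hY : ∀ j ∈ Y, ψ j ∈ X.image φ ∪ Y.image ψ := fun j hj =>
    mem_union_right _ (mem_image_of_mem _ hj)
  rw [card_filter_eq_eq_sum_mul hX, collisions_eq_sum_sq hX, collisions_eq_sum_sq hY]
  exact sum_mul_sq_le_sq_mul_sq _ _ _

theorem collisions_le_card_mul {φ : ι → γ} {X : Finset ι} {m : ℕ}
    (h : ∀ z, #{i ∈ X | φ i = z} ≤ m) : collisions φ X ≤ #X * m := by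
  rw [collisions_eq_sum]
  exact sum_le_card_nsmul _ _ _ fun i _ => h (φ i)

theorem mul_card_le_card_filter_mem {φ : ι → γ} {X : Finset ι} {Z : Finset γ} {m : ℕ}
    (h : ∀ z ∈ Z, m ≤ #{i ∈ X | φ i = z}) : m * #Z ≤ #{i ∈ X | φ i ∈ Z} := by
  refine mul_card_image_le_card_of_maps_to (fun i hi => (mem_filter.1 hi).2) m fun z hz =>
    (h z hz).trans (card_le_card ?_)
  rw [filter_filter]
  exact monotone_filter_right _ fun i _ hi => ⟨hi ▸ hz, hi⟩

theorem collisions_biUnion_le [DecidableEq ι] (φ : ι → γ) (s : Finset κ) (X : κ → Finset ι) :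
    collisions φ (s.biUnion X) ≤ #s * ∑ k ∈ s, collisions φ (X k) := by
  have hmaps : ∀ k ∈ s, ∀ i ∈ X k, φ i ∈ (s.biUnion X).image φ := fun k hk i hi =>
    mem_image_of_mem _ (mem_biUnion.2 ⟨k, hk, hi⟩)
  rw [collisions_eq_sum_sq fun i hi => mem_image_of_mem _ hi,
    sum_congr rfl fun k hk => collisions_eq_sum_sq (hmaps k hk), sum_comm, mul_sum]
  refine sum_le_sum fun z _ => ?_
  calc #{i ∈ s.biUnion X | φ i = z} ^ 2 ≤ (∑ k ∈ s, #{i ∈ X k | φ i = z}) ^ 2 := by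
        rw [filter_biUnion]
        exact Nat.pow_le_pow_left card_biUnion_le 2
    _ ≤ #s * ∑ k ∈ s, #{i ∈ X k | φ i = z} ^ 2 := sq_sum_le_card_mul_sum_sq

theorem collisions_union_le [DecidableEq ι] (φ : ι → γ) (X Y : Finset ι) :
    collisions φ (X ∪ Y) ≤ 2 * (collisions φ X + collisions φ Y) := by
  have hunion : (univ : Finset Bool).biUnion (fun b => bif b then X else Y) = X ∪ Y := by
    ext
    simp
  simpa [hunion] using collisions_biUnion_le φ univ fun b => bif b then X else Y

theorem exists_collisions_le_dyadic {φ : ι → γ} {X : Finset ι} {J : ℕ}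
    (hJ : ∀ z, #{i ∈ X | φ i = z} < 2 ^ J) :
    ∃ τ, collisions φ X ≤ 4 * J * (τ ^ 2 * #{z ∈ X.image φ | τ ≤ #{i ∈ X | φ i = z}}) := by
  obtain rfl | hX := X.eq_empty_or_nonempty
  · exact ⟨0, by simp [collisions]⟩
  have hpos : ∀ z ∈ X.image φ, #{i ∈ X | φ i = z} ≠ 0 := by
    intro z hz
    obtain ⟨i, hi, rfl⟩ := mem_image.1 hz
    exact card_ne_zero_of_mem (mem_filter.2 ⟨hi, rfl⟩)
  obtain ⟨j, -, hj⟩ := exists_sum_pow_le_dyadic (hX.image φ) hpos (fun z _ => hJ z) 2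
  refine ⟨2 ^ j, ?_⟩
  calc collisions φ X = ∑ z ∈ X.image φ, #{i ∈ X | φ i = z} ^ 2 :=
        collisions_eq_sum_sq fun i hi => mem_image_of_mem _ hi
    _ ≤ _ := hj
    _ ≤ J * (#{z ∈ X.image φ | 2 ^ j ≤ #{i ∈ X | φ i = z}} * (2 ^ (j + 1)) ^ 2) := by
        gcongr with z hz
        rintro rfl
        exact Nat.pow_log_le_self 2 (hpos z hz)
    _ = _ := by ring

theorem collisions_eq_card_add_card_offDiag (φ : ι → γ) (X : Finset ι) :
    collisions φ X = #X + #{q ∈ X.offDiag | φ q.1 = φ q.2} := by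
  classical
  have hdiag : {q ∈ X.diag | φ q.1 = φ q.2} = X.diag :=
    filter_true_of_mem fun q hq => by rw [(mem_diag.1 hq).2]
  rw [collisions, ← diag_union_offDiag, filter_union,
    card_union_of_disjoint (disjoint_filter_filter (disjoint_diag_offDiag X)), hdiag, diag_card]

theorem card_le_add_card_offDiag {φ : ι → γ} {X : Finset ι} {Z : Finset γ}
    (hZ : ∀ i ∈ X, φ i ∈ Z) : #X ≤ #Z + #{q ∈ X.offDiag | φ q.1 = φ q.2} := by
  have htwice : 2 * #X ≤ #Z + collisions φ X := by
    rw [collisions_eq_sum_sq hZ, card_eq_sum_card_fiberwise hZ, card_eq_sum_ones Z, mul_sum,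
      ← sum_add_distrib]
    exact sum_le_sum fun z _ => by nlinarith [sq_nonneg ((#{i ∈ X | φ i = z} : ℤ) - 1)]
  rw [collisions_eq_card_add_card_offDiag] at htwice
  omega

end Collisions

/-! ### Incidences of monotone curves with a grid -/

section Incidences

/-- The number of incidences between the grid `T × S` and the graphs of the functions `u i` for
`i ∈ L`. -/
def incidences [DecidableEq α] (u : ι → β → α) (L : Finset ι) (T : Finset β) (S : Finset α) : ℕ :=
  #{q ∈ L ×ˢ T | u q.1 q.2 ∈ S}

theorem incidences_eq_sum [DecidableEq α] (u : ι → β → α) (L : Finset ι) (T : Finset β)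
    (S : Finset α) :
    incidences u L T S = ∑ i ∈ L, #{t ∈ T | u i t ∈ S} := by
  simp only [incidences, card_filter, sum_product]

variable [LinearOrder α] [LinearOrder β]

theorem strictMonoOn_card_filter_lt (S : Finset α) : StrictMonoOn (fun x => #{y ∈ S | y < x}) S :=
  fun x hx _ _ hxy => card_lt_card <| Finset.ssubset_iff_subset_ne.2
    ⟨monotone_filter_right _ fun _ _ h => h.trans hxy, fun h =>
      lt_irrefl x (mem_filter.1 (h ▸ mem_filter.2 ⟨hx, hxy⟩ : x ∈ {y ∈ S | y < x})).2⟩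

/-- The index of the block containing `x` when the line is cut into consecutive blocks holding at
most `d` elements of `S` each. The products of such blocks are the cells of the grid in the
incidence bound. -/
def blockIndex (S : Finset α) (d : ℕ) (x : α) : ℕ := #{y ∈ S | y < x} / d

theorem blockIndex_mono (S : Finset α) (d : ℕ) : Monotone (blockIndex S d) := fun _ _ hxy =>
  Nat.div_le_div_right (card_le_card (monotone_filter_right _ fun _ _ h => h.trans_le hxy))

theorem blockIndex_le (S : Finset α) (d : ℕ) (x : α) : blockIndex S d x ≤ #S / d :=
  Nat.div_le_div_right (card_filter_le _ _)

theorem card_filter_blockIndex_le (S : Finset α) {d : ℕ} (hd : 0 < d) (k : ℕ) :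
    #{x ∈ S | blockIndex S d x = k} ≤ d := by
  have hmaps : ∀ x ∈ ({x ∈ S | blockIndex S d x = k} : Finset α),
      #{y ∈ S | y < x} ∈ Ico (k * d) ((k + 1) * d) := fun x hx => by
    have hk : #{y ∈ S | y < x} / d = k := (mem_filter.1 hx).2
    rw [mem_Ico, ← Nat.le_div_iff_mul_le hd, ← Nat.div_lt_iff_lt_mul hd]
    omega
  have hinj := (strictMonoOn_card_filter_lt S).injOn.mono
    (coe_subset.2 (filter_subset (fun x => blockIndex S d x = k) S))
  refine (card_le_card_of_injOn _ hmaps hinj).trans_eq ?_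
  rw [Nat.card_Ico, Nat.succ_mul, Nat.add_sub_cancel_left]

theorem collisions_blockIndex_le (S : Finset α) {d : ℕ} (hd : 0 < d) :
    collisions (blockIndex S d) S ≤ #S * d :=
  collisions_le_card_mul (card_filter_blockIndex_le S hd)

theorem eq_and_eq_of_add_eq_add_of_monotone {p q : β → ℕ} (hp : Monotone p) (hq : Monotone q)
    {t t' : β} (h : p t + q t = p t' + q t') : p t = p t' ∧ q t = q t' := by
  wlog htt : t ≤ t' generalizing t t'
  · exact (this h.symm (le_of_not_ge htt)).imp Eq.symm Eq.symm
  · have := hp htt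
    have := hq htt
    omega

/- The pair `(p t, q t)` moves along a staircase, which visits at most `m + n + 1` cells. -/
theorem card_le_add_card_offDiag_of_monotone {p q : β → ℕ} {m n : ℕ}
    (hp : Monotone p ∨ Antitone p) (hq : Monotone q) (hpm : ∀ t, p t ≤ m) (hqn : ∀ t, q t ≤ n)
    (X : Finset β) :
    #X ≤ m + n + 1 + #{x ∈ X.offDiag | p x.1 = p x.2 ∧ q x.1 = q x.2} := by
  wlog hmono : Monotone p generalizing p
  · have hanti : Antitone p := hp.resolve_left hmono
    have hreflect : Monotone fun t => m - p t := fun t t' htt => Nat.sub_le_sub_left (hanti htt) m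
    refine (this (Or.inl hreflect) (fun t => m.sub_le _) hreflect).trans
      (Nat.add_le_add_left (card_le_card (monotone_filter_right _ ?_)) _)
    rintro x - ⟨h, h'⟩
    have := hpm x.1
    have := hpm x.2
    exact ⟨by omega, h'⟩
  have hZ : ∀ t ∈ X, p t + q t ∈ range (m + n + 1) := fun t _ =>
    mem_range.2 (by have := hpm t; have := hqn t; omega)
  refine (card_le_add_card_offDiag hZ).trans ?_
  rw [card_range]
  gcongr with x
  exact eq_and_eq_of_add_eq_add_of_monotone hmono hq

variable {u : ι → β → α} {L : Finset ι}

theorem sum_card_offDiag_blockIndex_le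
    (hinj : ∀ t t', t ≠ t' → Set.InjOn (fun i => (u i t, u i t')) L) (T : Finset β) (S : Finset α)
    {d e : ℕ} (hd : 0 < d) (he : 0 < e) :
    ∑ i ∈ L, #{x ∈ ({t ∈ T | u i t ∈ S} : Finset β).offDiag |
      blockIndex S d (u i x.1) = blockIndex S d (u i x.2) ∧
        blockIndex T e x.1 = blockIndex T e x.2} ≤ #S * d * (#T * e) := by
  refine le_trans ?_
    (Nat.mul_le_mul (collisions_blockIndex_le S hd) (collisions_blockIndex_le T he))
  rw [collisions, collisions, ← card_product, ← card_sigma]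
  refine card_le_card_of_injOn (fun z => ((u z.1 z.2.1, u z.1 z.2.2), z.2)) ?_ ?_
  · rintro ⟨i, t, t'⟩ hz
    simp only [coe_sigma, Set.mem_sigma_iff, mem_coe, mem_filter, mem_offDiag, mem_product] at hz ⊢
    tauto
  · rintro ⟨i, t, t'⟩ hz ⟨i', s, s'⟩ hz' h
    simp only [coe_sigma, Set.mem_sigma_iff, mem_coe, mem_filter, mem_offDiag] at hz hz'
    obtain ⟨hu, rfl, rfl⟩ := by simpa only [Prod.mk.injEq] using h
    obtain rfl := hinj t t' hz.2.1.2.2 hz.1 hz'.1 (Prod.ext hu.1 hu.2)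
    rfl

theorem incidences_le (hmono : ∀ i ∈ L, Monotone (u i) ∨ Antitone (u i))
    (hinj : ∀ t t', t ≠ t' → Set.InjOn (fun i => (u i t, u i t')) L) (T : Finset β) (S : Finset α)
    {d e : ℕ} (hd : 0 < d) (he : 0 < e) :
    incidences u L T S ≤ (#S / d + #T / e + 1) * #L + #S * d * (#T * e) := by
  have hcurve : ∀ i ∈ L, _ := fun i hi => card_le_add_card_offDiag_of_monotone
    ((hmono i hi).imp (blockIndex_mono S d).comp (blockIndex_mono S d).comp_antitone)
    (blockIndex_mono T e) (fun t => blockIndex_le S d (u i t)) (blockIndex_le T e)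
    {t ∈ T | u i t ∈ S}
  rw [incidences_eq_sum]
  refine (sum_le_sum hcurve).trans ?_
  rw [sum_add_distrib, sum_const, smul_eq_mul, mul_comm #L]
  exact Nat.add_le_add_left (sum_card_offDiag_blockIndex_le hinj T S hd he) _

/- A Szemerédi–Trotter bound for rich curves, with the exponents of the Cartesian product case. -/
theorem pow_mul_card_le_of_le_incidences (hmono : ∀ i ∈ L, Monotone (u i) ∨ Antitone (u i))
    (hinj : ∀ t t', t ≠ t' → Set.InjOn (fun i => (u i t, u i t')) L) {T : Finset β} {S : Finset α}
    {r : ℕ} (hr : r ≤ #S) (hrich : 8 * r * #L ≤ incidences u L T S) :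
    r ^ 3 * #L ≤ #S ^ 2 * #T ^ 2 := by
  obtain rfl | hL := L.eq_empty_or_nonempty
  · simp
  obtain rfl | hr0 := r.eq_zero_or_pos
  · simp
  have hrT : r ≤ #T := by
    have : 8 * r * #L ≤ #T * #L :=
      hrich.trans ((card_filter_le _ _).trans_eq (by rw [card_product, mul_comm]))
    have := Nat.le_of_mul_le_mul_right this hL.card_pos
    omega
  have hquot : ∀ n, n / (n / r + 1) ≤ r := fun n =>
    Nat.le_of_lt_succ ((Nat.div_lt_iff_lt_mul (Nat.succ_pos _)).2
      ((Nat.lt_mul_div_succ n hr0).trans_le (Nat.mul_le_mul_right _ r.le_succ)))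
  have hsize : ∀ n, r ≤ n → r * (n / r + 1) ≤ 2 * n := fun n hn => by
    have := Nat.mul_div_le n r
    rw [mul_add_one]
    omega
  have hinc := hrich.trans
    (incidences_le hmono hinj T S (Nat.succ_pos (#S / r)) (Nat.succ_pos (#T / r)))
  simp only [Nat.succ_eq_add_one] at hinc
  have hcells : (#S / (#S / r + 1) + #T / (#T / r + 1) + 1) * #L ≤ 3 * r * #L :=
    Nat.mul_le_mul_right _ (by have := hquot #S; have := hquot #T; omega)
  have hfew : 4 * (r * #L) ≤ #S * (#S / r + 1) * (#T * (#T / r + 1)) := by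
    nlinarith
  refine Nat.le_of_mul_le_mul_left (c := 4) ?_ four_pos
  calc 4 * (r ^ 3 * #L) = r * r * (4 * (r * #L)) := by ring
    _ ≤ r * r * (#S * (#S / r + 1) * (#T * (#T / r + 1))) := by gcongr
    _ = #S * (r * (#S / r + 1)) * (#T * (r * (#T / r + 1))) := by ring
    _ ≤ #S * (2 * #S) * (#T * (2 * #T)) := Nat.mul_le_mul
        (Nat.mul_le_mul_left _ (hsize _ hr)) (Nat.mul_le_mul_left _ (hsize _ hrT))
    _ = 4 * (#S ^ 2 * #T ^ 2) := by ring

end Incidences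

/-! ### Energies of binary operations -/

section OpEnergy

/-- `g` is a quotient operation for `f` on `A`: the equation `f a b = f c d` can be rewritten as
`g a c = g d b`, which separates the first arguments of `f` from the second ones. For example,
subtraction is a quotient operation for addition. -/
structure HasQuotientOn (f : α → α → γ) (g : α → α → δ) (A : Finset α) : Prop where
  injOn : ∀ a ∈ A, Set.InjOn (f a) A
  eq_iff : ∀ a ∈ A, ∀ b ∈ A, ∀ c ∈ A, ∀ d ∈ A, f a b = f c d ↔ g a c = g d b

theorem HasQuotientOn.mono {f : α → α → γ} {g : α → α → δ} {A X : Finset α}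
    (H : HasQuotientOn f g A) (hX : X ⊆ A) : HasQuotientOn f g X where
  injOn a ha := (H.injOn a (hX ha)).mono hX
  eq_iff a ha b hb c hc d hd := H.eq_iff a (hX ha) b (hX hb) c (hX hc) d (hX hd)

variable [DecidableEq γ]

/-- The energy of a binary operation `f` between `X` and `Y`: the number of solutions of
`f a b = f c d` with `a, c ∈ X` and `b, d ∈ Y`. It makes the additive and the multiplicative energy
instances of one notion, so that the two halves of the theorem have a common proof. -/
def opEnergy (f : α → β → γ) (X : Finset α) (Y : Finset β) : ℕ :=
  collisions (fun p : α × β => f p.1 p.2) (X ×ˢ Y)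

theorem opEnergy_add [DecidableEq α] [Add α] (X Y : Finset α) :
    opEnergy (· + ·) X Y = addEnergy X Y :=
  (addEnergy_eq_card_filter X Y).symm

theorem opEnergy_mul [DecidableEq α] [Mul α] (X Y : Finset α) :
    opEnergy (· * ·) X Y = mulEnergy X Y :=
  (mulEnergy_eq_card_filter X Y).symm

theorem opEnergy_biUnion_le [DecidableEq α] (f : α → β → γ) (s : Finset ι)
    (X : ι → Finset α) (Y : Finset β) :
    opEnergy f (s.biUnion X) Y ≤ #s * ∑ i ∈ s, opEnergy f (X i) Y := by
  classical
  have hprod : s.biUnion X ×ˢ Y = s.biUnion fun i => X i ×ˢ Y := by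
    ext
    simp only [mem_product, mem_biUnion]
    tauto
  rw [opEnergy, hprod]
  exact collisions_biUnion_le _ s _

theorem opEnergy_le_two_mul_opEnergy_erase [DecidableEq α] (f : α → α → γ) (A : Finset α) (z : α) :
    opEnergy f A A ≤ 2 * opEnergy f (A.erase z) (A.erase z) + 8 * #A ^ 2 := by
  set R := {z} ×ˢ A ∪ A ×ˢ {z}
  have hR : #R ≤ 2 * #A := (card_union_le _ _).trans_eq (by simp [two_mul])
  have hcover : A ×ˢ A ⊆ A.erase z ×ˢ A.erase z ∪ R := fun p hp => by
    simp only [R, mem_union, mem_product, mem_erase, mem_singleton] at hp ⊢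
    tauto
  calc opEnergy f A A ≤ collisions (fun p : α × α => f p.1 p.2) (A.erase z ×ˢ A.erase z ∪ R) :=
        card_le_card (filter_subset_filter _ (product_subset_product hcover hcover))
    _ ≤ 2 * (opEnergy f (A.erase z) (A.erase z) + #R * #R) :=
        (collisions_union_le _ _ _).trans (Nat.mul_le_mul_left _ (Nat.add_le_add_left
          ((card_filter_le _ _).trans_eq (card_product _ _)) _))
    _ ≤ _ := by nlinarith

theorem card_filter_op_eq_le_card_left {f : α → β → γ} {X : Finset α} {Y : Finset β}
    (hf : ∀ a ∈ X, Set.InjOn (f a) Y) (y : γ) : #{p ∈ X ×ˢ Y | f p.1 p.2 = y} ≤ #X := by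
  refine card_le_card_of_injOn Prod.fst (fun p hp => (mem_product.1 (mem_filter.1 hp).1).1) ?_
  rintro ⟨a, b⟩ hp ⟨a', b'⟩ hp' rfl
  simp only [mem_coe, mem_filter, mem_product] at hp hp'
  rw [hf a hp.1.1 hp.1.2 hp'.1.2 (hp.2.trans hp'.2.symm)]

theorem card_filter_op_eq_le_card_right {f : α → β → γ} {X : Finset α} {Y : Finset β}
    (hf : ∀ b ∈ Y, Set.InjOn (fun a => f a b) X) (y : γ) :
    #{p ∈ X ×ˢ Y | f p.1 p.2 = y} ≤ #Y := by
  refine card_le_card_of_injOn Prod.snd (fun p hp => (mem_product.1 (mem_filter.1 hp).1).2) ?_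
  rintro ⟨a, b⟩ hp ⟨a', b'⟩ hp' rfl
  simp only [mem_coe, mem_filter, mem_product] at hp hp'
  rw [hf b hp.1.2 hp.1.1 hp'.1.1 (hp.2.trans hp'.2.symm)]

theorem opEnergy_self_le_card_pow {f : α → α → γ} {X : Finset α}
    (hf : ∀ a ∈ X, Set.InjOn (f a) X) : opEnergy f X X ≤ #X ^ 3 :=
  (collisions_le_card_mul (card_filter_op_eq_le_card_left hf)).trans_eq
    (by rw [card_product]; ring)

namespace HasQuotientOn

variable {f : α → α → γ} {g : α → α → δ} {A X Y : Finset α}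

theorem opEnergy_eq_card_filter [DecidableEq δ] (H : HasQuotientOn f g A) (hX : X ⊆ A)
    (hY : Y ⊆ A) :
    opEnergy f X Y = #{q ∈ (X ×ˢ X) ×ˢ (Y ×ˢ Y) | g q.1.1 q.1.2 = g q.2.1 q.2.2} := by
  refine card_nbij' (fun q => ((q.1.1, q.2.1), (q.2.2, q.1.2)))
    (fun q => ((q.1.1, q.2.2), (q.1.2, q.2.1))) ?_ ?_ (fun _ _ => rfl) fun _ _ => rfl
  · rintro ⟨⟨a, b⟩, c, d⟩ hq
    simp only [mem_coe, mem_filter, mem_product] at hq ⊢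
    obtain ⟨⟨⟨ha, hb⟩, hc, hd⟩, h⟩ := hq
    exact ⟨⟨⟨ha, hc⟩, hd, hb⟩, (H.eq_iff a (hX ha) b (hY hb) c (hX hc) d (hY hd)).1 h⟩
  · rintro ⟨⟨a, c⟩, d, b⟩ hq
    simp only [mem_coe, mem_filter, mem_product] at hq ⊢
    obtain ⟨⟨⟨ha, hc⟩, hd, hb⟩, h⟩ := hq
    exact ⟨⟨⟨ha, hb⟩, hc, hd⟩, (H.eq_iff a (hX ha) b (hY hb) c (hX hc) d (hY hd)).2 h⟩

theorem opEnergy_self_eq [DecidableEq δ] (H : HasQuotientOn f g A) :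
    opEnergy f A A = opEnergy g A A :=
  H.opEnergy_eq_card_filter subset_rfl subset_rfl

theorem opEnergy_sq_le (H : HasQuotientOn f g A) (hX : X ⊆ A) (hY : Y ⊆ A) :
    opEnergy f X Y ^ 2 ≤ opEnergy f X X * opEnergy f Y Y := by
  classical
  rw [H.opEnergy_eq_card_filter hX hY, (H.mono hX).opEnergy_self_eq, (H.mono hY).opEnergy_self_eq]
  exact card_filter_eq_sq_le (fun p : α × α => g p.1 p.2) (fun p : α × α => g p.1 p.2) _ _

/- Two applications of the Cauchy–Schwarz inequality: the half of the energy carried by `X` is at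
most `opEnergy f X X ^ (1 / 4) * opEnergy f A A ^ (3 / 4)`. -/
theorem opEnergy_le_card_pow_of_half_mass (H : HasQuotientOn f g A) (hX : X ⊆ A)
    (hhalf : opEnergy f A A ≤
      2 * #{q ∈ (X ×ˢ A) ×ˢ (A ×ˢ A) | f q.1.1 q.1.2 = f q.2.1 q.2.2}) :
    opEnergy f A A ≤ 16 * #X ^ 3 := by
  have hmix : #{q ∈ (X ×ˢ A) ×ˢ (A ×ˢ A) | f q.1.1 q.1.2 = f q.2.1 q.2.2} ^ 2 ≤
      opEnergy f X A * opEnergy f A A :=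
    card_filter_eq_sq_le (fun p : α × α => f p.1 p.2) (fun p : α × α => f p.1 p.2) _ _
  have hrect := H.opEnergy_sq_le hX subset_rfl
  have hcube := opEnergy_self_le_card_pow (H.mono hX).injOn
  set M := opEnergy f A A
  set W := #{q ∈ (X ×ˢ A) ×ˢ (A ×ˢ A) | f q.1.1 q.1.2 = f q.2.1 q.2.2}
  obtain hM | hM := M.eq_zero_or_pos
  · omega
  refine Nat.le_of_mul_le_mul_right (c := M ^ 3) ?_ (by positivity)
  calc M * M ^ 3 = M ^ 4 := by ring
    _ ≤ (2 * W) ^ 4 := by gcongr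
    _ = 16 * (W ^ 2) ^ 2 := by ring
    _ ≤ 16 * (opEnergy f X A * M) ^ 2 := by gcongr
    _ = 16 * (opEnergy f X A ^ 2 * M ^ 2) := by ring
    _ ≤ 16 * (#X ^ 3 * M * M ^ 2) := by
        have := hrect.trans (Nat.mul_le_mul_right M hcube)
        gcongr
    _ = 16 * #X ^ 3 * M ^ 3 := by ring

end HasQuotientOn

end OpEnergy

/-! ### Popular values -/

section Popular

variable [DecidableEq γ]

/-- The number of representations of `y` as `f a b` with `a, b ∈ A`. -/
def repCount (f : α → α → γ) (A : Finset α) (y : γ) : ℕ := #{p ∈ A ×ˢ A | f p.1 p.2 = y}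

/-- The `j`-th dyadic level set of the representation function of `f` on `A`, consisting of the
values with at least `2 ^ j` and less than `2 ^ (j + 1)` representations. -/
def popularLevel (f : α → α → γ) (A : Finset α) (j : ℕ) : Finset γ :=
  {y ∈ (A ×ˢ A).image fun p => f p.1 p.2 | Nat.log 2 (repCount f A y) = j}

/-- The elements `a ∈ A` for which `f a b` lies in `popularLevel f A j` for so many `b ∈ A` that
they would contribute an average share of the energy, if it were carried by one of `J` levels only
(up to a factor `4`). -/
def popularClass (f : α → α → γ) (A : Finset α) (J j : ℕ) : Finset α :=
  {a ∈ A | opEnergy f A A ≤ 4 * #A * J * 2 ^ j * #{b ∈ A | f a b ∈ popularLevel f A j}}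

theorem opEnergy_eq_sum_repCount (f : α → α → γ) (A : Finset α) :
    opEnergy f A A = ∑ a ∈ A, ∑ b ∈ A, repCount f A (f a b) := by
  rw [opEnergy, collisions_eq_sum, sum_product]
  rfl

theorem mem_image_op {f : α → α → γ} {A : Finset α} {a b : α} (ha : a ∈ A) (hb : b ∈ A) :
    f a b ∈ (A ×ˢ A).image fun p => f p.1 p.2 :=
  mem_image_of_mem (fun p : α × α => f p.1 p.2) (mk_mem_product ha hb)

theorem repCount_ne_zero {f : α → α → γ} {A : Finset α} {y : γ}
    (hy : y ∈ (A ×ˢ A).image fun p => f p.1 p.2) : repCount f A y ≠ 0 := by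
  obtain ⟨p, hp, rfl⟩ := mem_image.1 hy
  exact card_ne_zero_of_mem (mem_filter.2 ⟨hp, rfl⟩)

theorem card_popularLevel_mul_le (f : α → α → γ) (A : Finset α) (j : ℕ) :
    #(popularLevel f A j) * (2 ^ j) ^ 2 ≤ opEnergy f A A := by
  rw [opEnergy, collisions_eq_sum_sq fun p hp =>
    mem_image_of_mem (fun p : α × α => f p.1 p.2) hp, ← smul_eq_mul]
  refine (card_nsmul_le_sum _ _ _ fun y hy => ?_).trans (sum_le_sum_of_subset (filter_subset _ _))
  obtain ⟨hy', rfl⟩ := mem_filter.1 hy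
  exact Nat.pow_le_pow_left (Nat.pow_log_le_self 2 (repCount_ne_zero hy')) 2

theorem popularClass_subset (f : α → α → γ) (A : Finset α) (J j : ℕ) : popularClass f A J j ⊆ A :=
  filter_subset _ _

theorem filter_opEnergy_le_subset_biUnion_popularClass [DecidableEq α] {f : α → α → γ}
    {A : Finset α} {J : ℕ} (hJ : ∀ y, repCount f A y < 2 ^ J) :
    {a ∈ A | opEnergy f A A ≤ 2 * #A * ∑ b ∈ A, repCount f A (f a b)} ⊆
      (range J).biUnion (popularClass f A J) := by
  intro a ha
  obtain ⟨ha, hheavy⟩ := mem_filter.1 ha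
  obtain ⟨j, hj, hle⟩ := exists_sum_pow_le_dyadic ⟨a, ha⟩
    (fun b hb => repCount_ne_zero (mem_image_op ha hb)) (fun b _ => hJ (f a b)) 1
  have hlevel : {b ∈ A | Nat.log 2 (repCount f A (f a b)) = j} =
      {b ∈ A | f a b ∈ popularLevel f A j} :=
    filter_congr fun b hb => by simp only [popularLevel, mem_filter, mem_image_op ha hb, true_and]
  simp only [pow_one, hlevel] at hle
  refine mem_biUnion.2 ⟨j, hj, mem_filter.2 ⟨ha, hheavy.trans ?_⟩⟩
  calc 2 * #A * ∑ b ∈ A, repCount f A (f a b)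
      ≤ 2 * #A * (J * (#{b ∈ A | f a b ∈ popularLevel f A j} * 2 ^ (j + 1))) := by gcongr
    _ = 4 * #A * J * 2 ^ j * #{b ∈ A | f a b ∈ popularLevel f A j} := by ring

theorem HasQuotientOn.opEnergy_le_card_biUnion_popularClass_pow [DecidableEq α]
    {f : α → α → γ} {g : α → α → δ} {A : Finset α} {J : ℕ} (H : HasQuotientOn f g A)
    (hJ : #A < 2 ^ J) :
    opEnergy f A A ≤ 16 * #((range J).biUnion (popularClass f A J)) ^ 3 := by
  have hrep : ∀ y, repCount f A y < 2 ^ J := fun y =>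
    (card_filter_op_eq_le_card_left H.injOn y).trans_lt hJ
  refine H.opEnergy_le_card_pow_of_half_mass
    (biUnion_subset.2 fun j _ => popularClass_subset f A J j) ?_
  have hhalf := sum_le_two_mul_sum_filter_le_mul A fun a => ∑ b ∈ A, repCount f A (f a b)
  rw [← opEnergy_eq_sum_repCount] at hhalf
  rw [card_filter_eq_eq_sum (fun p : α × α => f p.1 p.2) fun p : α × α => f p.1 p.2, sum_product]
  exact hhalf.trans (Nat.mul_le_mul_left _
    (sum_le_sum_of_subset (filter_opEnergy_le_subset_biUnion_popularClass hrep)))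

end Popular

/-! ### Curve models -/

section CurveModel

/-- For `c ∈ A` and a value `x` of `h`, the function `u c x` has a monotone graph which contains
the point `(b, f a c)` whenever `x = h a b` with `a, b ∈ A`, and these curves are determined by any
two of their points. Many coincidences among the values `h a b` thus force many incidences of the
curves with a grid `S × P` as soon as `f a c ∈ P` for many pairs `(a, c)`. -/
structure IsCurveModel [Preorder α] [Preorder γ] (f : α → α → γ) (h : α → α → κ)
    (u : α → κ → α → γ) (A : Finset α) : Prop where
  eval : ∀ a ∈ A, ∀ b ∈ A, ∀ c ∈ A, u c (h a b) b = f a c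
  injOn : ∀ b ∈ A, Set.InjOn (fun a => h a b) A
  monotone_or_antitone : ∀ c x, Monotone (u c x) ∨ Antitone (u c x)
  curve_injOn : ∀ t t', t ≠ t' →
    Set.InjOn (fun p : α × κ => (u p.1 p.2 t, u p.1 p.2 t')) {p | p.1 ∈ A}

theorem richness_le_of_incidences_bound {N p x θ τ : ℕ} (hθ : θ ≤ p) (hτ : τ ≤ N)
    (hτx : τ * x ≤ N ^ 2)
    (hrich : ∀ r ≤ p, 8 * r * (N * x) ≤ θ * τ * x → r ^ 3 * (N * x) ≤ p ^ 2 * N ^ 2) :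
    (τ ^ 2 * x) ^ 2 * θ ^ 3 ≤ 2 ^ 12 * N ^ 6 * p ^ 2 := by
  obtain rfl | hN := N.eq_zero_or_pos
  · simp [Nat.le_zero.1 hτ]
  obtain hsmall | hlarge := le_or_gt (θ * τ) (8 * N)
  · calc (τ ^ 2 * x) ^ 2 * θ ^ 3 = (θ * τ) ^ 2 * (τ * x) ^ 2 * θ := by ring
      _ ≤ (8 * N) ^ 2 * (N ^ 2) ^ 2 * p ^ 2 := by
          have := hθ.trans (Nat.le_self_pow two_ne_zero p)
          gcongr
      _ ≤ 2 ^ 12 * N ^ 6 * p ^ 2 := by nlinarith [Nat.zero_le (N ^ 6 * p ^ 2)]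
  set r := θ * τ / (8 * N)
  have hr : 8 * N * r ≤ θ * τ := Nat.mul_div_le _ _
  have hr' : θ * τ ≤ 16 * N * r := by
    have : θ * τ < 8 * N * (r + 1) := Nat.lt_mul_div_succ _ (by positivity)
    have : 1 ≤ r := Nat.div_pos hlarge.le (by positivity)
    nlinarith
  have hrp : r ≤ p := by
    refine Nat.div_le_of_le_mul ?_
    nlinarith [Nat.mul_le_mul hθ hτ]
  have hcube := hrich r hrp (by nlinarith [Nat.mul_le_mul_right x hr])
  refine Nat.le_of_mul_le_mul_right (c := N) ?_ hN
  calc (τ ^ 2 * x) ^ 2 * θ ^ 3 * N = (θ * τ) ^ 3 * (N * x) * (τ * x) := by ring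
    _ ≤ (16 * N * r) ^ 3 * (N * x) * N ^ 2 := by gcongr
    _ = 2 ^ 12 * N ^ 5 * (r ^ 3 * (N * x)) := by ring
    _ ≤ 2 ^ 12 * N ^ 5 * (p ^ 2 * N ^ 2) := by gcongr
    _ = 2 ^ 12 * N ^ 6 * p ^ 2 * N := by ring

namespace IsCurveModel

variable [LinearOrder α] [LinearOrder γ] [DecidableEq κ] {f : α → α → γ} {h : α → α → κ}
  {u : α → κ → α → γ} {A B S : Finset α} {P : Finset γ}

theorem mul_card_le_incidences (H : IsCurveModel f h u A) (hB : B ⊆ A) (hS : S ⊆ A) {θ τ : ℕ}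
    (hθ : ∀ a ∈ B, θ ≤ #{c ∈ A | f a c ∈ P}) {X : Finset κ}
    (hX : ∀ x ∈ X, τ ≤ #{p ∈ B ×ˢ S | h p.1 p.2 = x}) :
    θ * τ * #X ≤ incidences (fun p : α × κ => u p.1 p.2) (A ×ˢ X) S P := by
  set Y := {p ∈ B ×ˢ S | h p.1 p.2 ∈ X}
  have hmem : ∀ a b, (a, b) ∈ Y → (a ∈ B ∧ b ∈ S) ∧ h a b ∈ X := fun a b hab => by
    simpa only [Y, mem_filter, mem_product] using hab
  have hY : τ * #X ≤ #Y := mul_card_le_card_filter_mem hX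
  calc θ * τ * #X ≤ #Y * θ := by nlinarith
    _ ≤ ∑ p ∈ Y, #{c ∈ A | f p.1 c ∈ P} :=
        card_nsmul_le_sum _ _ _ fun p hp => hθ _ (hmem _ _ hp).1.1
    _ = #(Y.sigma fun p => {c ∈ A | f p.1 c ∈ P}) := (card_sigma _ _).symm
    _ ≤ incidences (fun p : α × κ => u p.1 p.2) (A ×ˢ X) S P := by
        refine card_le_card_of_injOn (fun z => ((z.2, h z.1.1 z.1.2), z.1.2)) ?_ ?_
        · rintro ⟨⟨a, b⟩, c⟩ hz
          simp only [coe_sigma, Set.mem_sigma_iff, mem_coe, mem_filter, mem_product] at hz ⊢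
          obtain ⟨⟨ha, hb⟩, hx⟩ := hmem a b hz.1
          exact ⟨⟨⟨hz.2.1, hx⟩, hb⟩, by rw [H.eval a (hB ha) b (hS hb) c hz.2.1]; exact hz.2.2⟩
        · rintro ⟨⟨a, b⟩, c⟩ hz ⟨⟨a', b'⟩, c'⟩ hz' heq
          simp only [coe_sigma, Set.mem_sigma_iff, mem_coe] at hz hz'
          obtain ⟨⟨rfl, hx⟩, rfl⟩ := by simpa only [Prod.mk.injEq] using heq
          obtain rfl := H.injOn b (hS (hmem a b hz.1).1.2) (hB (hmem a b hz.1).1.1)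
            (hB (hmem a' b hz'.1).1.1) hx
          rfl

theorem card_rich_le (H : IsCurveModel f h u A) (hB : B ⊆ A) (hS : S ⊆ A)
    (hf : ∀ a ∈ A, Set.InjOn (f a) A) {θ : ℕ} (hθ : ∀ a ∈ B, θ ≤ #{c ∈ A | f a c ∈ P}) (τ : ℕ) :
    (τ ^ 2 * #{x ∈ (B ×ˢ S).image fun p => h p.1 p.2 | τ ≤ #{p ∈ B ×ˢ S | h p.1 p.2 = x}}) ^ 2 *
      θ ^ 3 ≤ 2 ^ 12 * #A ^ 6 * #P ^ 2 := by
  set X := {x ∈ (B ×ˢ S).image fun p => h p.1 p.2 | τ ≤ #{p ∈ B ×ˢ S | h p.1 p.2 = x}}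
  have hX : ∀ x ∈ X, τ ≤ #{p ∈ B ×ˢ S | h p.1 p.2 = x} := fun x hx => (mem_filter.1 hx).2
  obtain hXe | ⟨x, hx⟩ := X.eq_empty_or_nonempty
  · simp [hXe]
  obtain ⟨⟨a, b⟩, hab, -⟩ := mem_image.1 (mem_filter.1 hx).1
  have ha : a ∈ B := (mem_product.1 hab).1
  have hSA : #S ≤ #A := card_le_card hS
  have hθP : θ ≤ #P := (hθ a ha).trans (card_le_card_of_injOn (f a)
    (fun c hc => (mem_filter.1 hc).2) ((hf a (hB ha)).mono (coe_subset.2 (filter_subset _ _))))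
  have hτA : τ ≤ #A := ((hX x hx).trans (card_filter_op_eq_le_card_right
    (fun b hb => (H.injOn b (hS hb)).mono hB) x)).trans hSA
  have hτX : τ * #X ≤ #A ^ 2 := by
    refine (mul_card_le_card_filter_mem hX).trans ?_
    rw [sq, ← card_product]
    exact card_le_card ((filter_subset _ _).trans (product_subset_product hB hS))
  refine richness_le_of_incidences_bound hθP hτA hτX fun r hr hle => ?_
  rw [← card_product] at hle ⊢
  refine (pow_mul_card_le_of_le_incidences (fun p _ => H.monotone_or_antitone p.1 p.2)
    (fun t t' ht => (H.curve_injOn t t' ht).mono fun p hp => (mem_product.1 hp).1) hr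
    (hle.trans (H.mul_card_le_incidences hB hS hθ hX))).trans ?_
  gcongr

theorem opEnergy_mul_sq_le (H : IsCurveModel f h u A) (hB : B ⊆ A) (hS : S ⊆ A)
    (hf : ∀ a ∈ A, Set.InjOn (f a) A) {J M t : ℕ} (hJ : #A < 2 ^ J) (hP : #P * t ^ 2 ≤ M)
    (hM : ∀ a ∈ B, M ≤ 4 * #A * J * t * #{c ∈ A | f a c ∈ P}) :
    (opEnergy h B S * M) ^ 2 ≤ 2 ^ 24 * J ^ 6 * #A ^ 11 := by
  obtain rfl | hBne := B.eq_empty_or_nonempty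
  · simp [opEnergy, collisions]
  obtain rfl | hM0 := M.eq_zero_or_pos
  · simp
  obtain ⟨a, ha, hmin⟩ := exists_min_image B (fun a => #{c ∈ A | f a c ∈ P}) hBne
  have hfib : ∀ x, #{p ∈ B ×ˢ S | h p.1 p.2 = x} < 2 ^ J := fun x =>
    ((card_filter_op_eq_le_card_right (fun b hb => (H.injOn b (hS hb)).mono hB) x).trans
      (card_le_card hS)).trans_lt hJ
  obtain ⟨τ, hτ⟩ := exists_collisions_le_dyadic hfib
  have hrich := H.card_rich_le hB hS hf hmin τ
  have hMθ := hM a ha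
  have hθA : #{c ∈ A | f a c ∈ P} ≤ #A := card_filter_le _ _
  set R := τ ^ 2 * #{x ∈ (B ×ˢ S).image fun p => h p.1 p.2 | τ ≤ #{p ∈ B ×ˢ S | h p.1 p.2 = x}}
  set θ := #{c ∈ A | f a c ∈ P}
  have hpos : 0 < t * θ := Nat.pos_of_ne_zero fun h0 => by
    rw [mul_assoc _ t, h0] at hMθ
    omega
  refine Nat.le_of_mul_le_mul_right (c := (t * θ) ^ 4) ?_ (by positivity)
  calc (opEnergy h B S * M) ^ 2 * (t * θ) ^ 4 ≤ (4 * J * R * M) ^ 2 * (t * θ) ^ 4 := by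
        rw [opEnergy]
        gcongr
    _ = 2 ^ 4 * J ^ 2 * (R ^ 2 * θ ^ 3) * M ^ 2 * t ^ 4 * θ := by ring
    _ ≤ 2 ^ 4 * J ^ 2 * (2 ^ 12 * #A ^ 6 * #P ^ 2) * M ^ 2 * t ^ 4 * #A := by gcongr
    _ = 2 ^ 16 * J ^ 2 * #A ^ 7 * M ^ 2 * (#P * t ^ 2) ^ 2 := by ring
    _ ≤ 2 ^ 16 * J ^ 2 * #A ^ 7 * M ^ 2 * M ^ 2 := by gcongr
    _ = 2 ^ 16 * J ^ 2 * #A ^ 7 * M ^ 4 := by ring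
    _ ≤ 2 ^ 16 * J ^ 2 * #A ^ 7 * (4 * #A * J * t * θ) ^ 4 := by gcongr
    _ = 2 ^ 24 * J ^ 6 * #A ^ 11 * (t * θ) ^ 4 := by ring

end IsCurveModel

end CurveModel

/-! ### Subsets of large size and small energy -/

theorem exists_subset_opEnergy_mul_sq_le [LinearOrder α] [LinearOrder γ] [DecidableEq κ]
    {f : α → α → γ} {g : α → α → δ} {h : α → α → κ} {u : α → κ → α → γ}
    {A : Finset α} (Q : HasQuotientOn f g A) (H : IsCurveModel f h u A) {J : ℕ} (hJ : #A < 2 ^ J) :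
    ∃ S ⊆ A, opEnergy f A A ≤ 16 * #S ^ 3 ∧
      (opEnergy h S S * opEnergy f A A) ^ 2 ≤ 2 ^ 24 * J ^ 10 * #A ^ 11 := by
  set B := popularClass f A J
  set S := (range J).biUnion B
  set M := opEnergy f A A
  have hS : S ⊆ A := biUnion_subset.2 fun j _ => popularClass_subset f A J j
  have hclass : ∀ j ∈ range J, (opEnergy h (B j) S * M) ^ 2 ≤ 2 ^ 24 * J ^ 6 * #A ^ 11 :=
    fun j _ => H.opEnergy_mul_sq_le (popularClass_subset f A J j) hS Q.injOn hJ
      (card_popularLevel_mul_le f A j) fun a ha => (mem_filter.1 ha).2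
  refine ⟨S, hS, Q.opEnergy_le_card_biUnion_popularClass_pow hJ, ?_⟩
  calc (opEnergy h S S * M) ^ 2 ≤ (J * (∑ j ∈ range J, opEnergy h (B j) S) * M) ^ 2 := by
        have := opEnergy_biUnion_le h (range J) B S
        rw [card_range] at this
        gcongr
    _ = J ^ 2 * (∑ j ∈ range J, opEnergy h (B j) S * M) ^ 2 := by rw [← sum_mul]; ring
    _ ≤ J ^ 2 * (J * ∑ j ∈ range J, (opEnergy h (B j) S * M) ^ 2) := by
        have := sq_sum_le_card_mul_sum_sq (s := range J) (f := fun j => opEnergy h (B j) S * M)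
        simp only [card_range, Nat.cast_id] at this
        gcongr
    _ ≤ J ^ 2 * (J * (J * (2 ^ 24 * J ^ 6 * #A ^ 11))) := by
        have := sum_le_card_nsmul _ _ _ hclass
        rw [card_range, smul_eq_mul] at this
        gcongr
    _ = 2 ^ 24 * J ^ 10 * #A ^ 11 := by ring

theorem natCast_rpow_one_third_le {m n : ℕ} (h : m ≤ n ^ 3) : (m : ℝ) ^ (1 / 3 : ℝ) ≤ n := by
  rw [one_div]
  refine (Real.rpow_inv_le_iff_of_pos (by positivity) (by positivity) (by norm_num)).2 ?_
  exact_mod_cast h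

theorem natLog_two_add_one_le {N : ℕ} (hN : 2 ≤ N) :
    ((Nat.log 2 N + 1 : ℕ) : ℝ) ≤ 4 * Real.log N := by
  have hlog : Real.log 2 ≤ Real.log N := Real.log_le_log two_pos (by exact_mod_cast hN)
  have hlogb := Real.natLog_le_logb N 2
  rw [Nat.cast_ofNat, Real.logb, le_div_iff₀ (by positivity)] at hlogb
  have := Real.log_two_gt_d9
  push_cast
  nlinarith

theorem le_mul_rpow_mul_log_pow {E N : ℕ} (hN : 2 ≤ N)
    (hE : E ^ 2 ≤ 2 ^ 28 * (Nat.log 2 N + 1) ^ 10 * N ^ 11) :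
    (E : ℝ) ≤ 2 ^ 24 * ((N : ℝ) ^ (11 / 2 : ℝ) * Real.log N ^ (5 : ℝ)) := by
  have hroot : ((N : ℝ) ^ (11 / 2 : ℝ)) ^ 2 = (N : ℝ) ^ 11 := by
    rw [← Real.rpow_mul_natCast (by positivity), ← Real.rpow_natCast]
    norm_num
  have hlog := natLog_two_add_one_le hN
  have hlogpow : Real.log N ^ (5 : ℝ) = Real.log N ^ 5 := Real.rpow_natCast _ 5
  have hsq : (E : ℝ) ^ 2 ≤ 2 ^ 28 * ((Nat.log 2 N + 1 : ℕ) : ℝ) ^ 10 * (N : ℝ) ^ 11 := by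
    exact_mod_cast hE
  rw [hlogpow]
  calc (E : ℝ) ≤ 2 ^ 14 * ((Nat.log 2 N + 1 : ℕ) : ℝ) ^ 5 * (N : ℝ) ^ (11 / 2 : ℝ) := by
        refine le_of_sq_le_sq (hsq.trans_eq ?_) (by positivity)
        rw [← hroot]
        ring
    _ ≤ 2 ^ 14 * (4 * Real.log N) ^ 5 * (N : ℝ) ^ (11 / 2 : ℝ) := by gcongr
    _ = 2 ^ 24 * ((N : ℝ) ^ (11 / 2 : ℝ) * Real.log N ^ 5) := by ring

section Erase

variable [LinearOrder α] [LinearOrder γ] {f f' : α → α → γ}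
  {g : α → α → δ} {h : α → α → κ} {u : α → κ → α → γ} {A : Finset α} {z : α}

theorem exists_subset_opEnergy_mul_sq_le_of_erase (Q : HasQuotientOn f g (A.erase z))
    (Q' : HasQuotientOn f' h (A.erase z)) (H : IsCurveModel f h u (A.erase z)) {J : ℕ}
    (hJ : #A < 2 ^ J) :
    ∃ S ⊆ A, opEnergy f A A ≤ 64 * #S ^ 3 ∧
      (opEnergy f' S S * opEnergy f A A) ^ 2 ≤ 2 ^ 28 * J ^ 10 * #A ^ 11 := by
  classical
  obtain rfl | hA := A.eq_empty_or_nonempty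
  · exact ⟨∅, subset_rfl, by simp [opEnergy, collisions]⟩
  have hle : #(A.erase z) ≤ #A := card_erase_le
  have hN := hA.card_pos
  obtain hsmall | hlarge := le_or_gt (opEnergy f A A) (16 * #A ^ 2)
  · have hJ1 : 1 ≤ J := Nat.pos_of_ne_zero fun h0 => by
      rw [h0, pow_zero] at hJ
      omega
    have hf' : opEnergy f' A A ≤ 10 * #A ^ 3 := by
      calc opEnergy f' A A ≤ 2 * #(A.erase z) ^ 3 + 8 * #A ^ 2 :=
            (opEnergy_le_two_mul_opEnergy_erase f' A z).trans
              (by have := opEnergy_self_le_card_pow Q'.injOn; gcongr)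
        _ ≤ 2 * #A ^ 3 + 8 * #A ^ 3 := by gcongr; norm_num
        _ = 10 * #A ^ 3 := by ring
    refine ⟨A, subset_rfl, hsmall.trans (by gcongr <;> norm_num), ?_⟩
    calc (opEnergy f' A A * opEnergy f A A) ^ 2 ≤ (10 * #A ^ 3 * (16 * #A ^ 2)) ^ 2 := by gcongr
      _ = 25600 * 1 ^ 10 * #A ^ 10 := by ring
      _ ≤ 2 ^ 28 * J ^ 10 * #A ^ 11 := by gcongr <;> norm_num
  · obtain ⟨S, hS, hcard, hE⟩ := exists_subset_opEnergy_mul_sq_le Q H (hle.trans_lt hJ)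
    have hM : opEnergy f A A ≤ 4 * opEnergy f (A.erase z) (A.erase z) := by
      have := opEnergy_le_two_mul_opEnergy_erase f A z
      omega
    refine ⟨S, hS.trans (erase_subset _ _), by omega, ?_⟩
    rw [(Q'.mono hS).opEnergy_self_eq]
    calc (opEnergy h S S * opEnergy f A A) ^ 2
        ≤ (opEnergy h S S * (4 * opEnergy f (A.erase z) (A.erase z))) ^ 2 := by gcongr
      _ = 2 ^ 4 * (opEnergy h S S * opEnergy f (A.erase z) (A.erase z)) ^ 2 := by ring
      _ ≤ 2 ^ 4 * (2 ^ 24 * J ^ 10 * #A ^ 11) := by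
          have := hE.trans (Nat.mul_le_mul_left _ (Nat.pow_le_pow_left hle 11))
          gcongr
      _ = 2 ^ 28 * J ^ 10 * #A ^ 11 := by ring

theorem exists_subset_rpow_opEnergy_le (Q : HasQuotientOn f g (A.erase z))
    (Q' : HasQuotientOn f' h (A.erase z)) (H : IsCurveModel f h u (A.erase z)) (hA : 2 ≤ #A) :
    ∃ S ⊆ A, 1 / 4 * (opEnergy f A A : ℝ) ^ (1 / 3 : ℝ) ≤ #S ∧
      (opEnergy f' S S : ℝ) * opEnergy f A A ≤
        2 ^ 24 * ((#A : ℝ) ^ (11 / 2 : ℝ) * Real.log #A ^ (5 : ℝ)) := by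
  obtain ⟨S, hS, hcard, hE⟩ := exists_subset_opEnergy_mul_sq_le_of_erase Q Q' H
    (Nat.lt_pow_succ_log_self one_lt_two #A)
  refine ⟨S, hS, ?_, by exact_mod_cast le_mul_rpow_mul_log_pow hA hE⟩
  have := natCast_rpow_one_third_le (n := 4 * #S) (hcard.trans_eq (by ring))
  push_cast at this
  linarith

end Erase

/-! ### Addition and multiplication in an ordered field -/

section OrderedField

variable {K : Type*} [Field K]

theorem hasQuotientOn_add_sub (A : Finset K) : HasQuotientOn (· + ·) (· - ·) A where
  injOn _ _ := (add_right_injective _).injOn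
  eq_iff a _ b _ c _ d _ := by rw [sub_eq_sub_iff_add_eq_add, add_comm d c]

theorem hasQuotientOn_mul_div {A : Finset K} (hA : 0 ∉ A) :
    HasQuotientOn (· * ·) (· / ·) A where
  injOn a ha := (mul_right_injective₀ (ne_of_mem_of_not_mem ha hA)).injOn
  eq_iff a _ b hb c hc d _ := by
    rw [div_eq_div_iff (ne_of_mem_of_not_mem hc hA) (ne_of_mem_of_not_mem hb hA), mul_comm d c]

variable [LinearOrder K] [IsStrictOrderedRing K]

theorem isCurveModel_mul_sub {A : Finset K} (hA : 0 ∉ A) :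
    IsCurveModel (· * ·) (· - ·) (fun c x b => (x + b) * c) A where
  eval a _ b _ c _ := by rw [sub_add_cancel]
  injOn b _ := (sub_left_injective (b := b)).injOn
  monotone_or_antitone c x := (le_total 0 c).imp
    (fun hc _ _ h => mul_le_mul_of_nonneg_right (add_le_add_right h x) hc)
    fun hc _ _ h => mul_le_mul_of_nonpos_right (add_le_add_right h x) hc
  curve_injOn t t' ht := by
    rintro ⟨c, x⟩ hc ⟨c', x'⟩ - heq
    obtain ⟨h, h'⟩ : (x + t) * c = (x' + t) * c' ∧ (x + t') * c = (x' + t') * c' :=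
      Prod.ext_iff.1 heq
    obtain rfl : c = c' := mul_left_cancel₀ (sub_ne_zero.2 ht) (by linear_combination h - h')
    have := mul_right_cancel₀ (ne_of_mem_of_not_mem (show c ∈ A from hc) hA) h
    rw [add_right_cancel this]

theorem isCurveModel_add_div {A : Finset K} (hA : 0 ∉ A) :
    IsCurveModel (· + ·) (· / ·) (fun c x b => x * b + c) A where
  eval a _ b hb c _ := by rw [div_mul_cancel₀ a (ne_of_mem_of_not_mem hb hA)]
  injOn b hb _ _ _ _ h := (div_left_inj' (ne_of_mem_of_not_mem hb hA)).1 h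
  monotone_or_antitone c x := (le_total 0 x).imp
    (fun hx _ _ h => add_le_add_left (mul_le_mul_of_nonneg_left h hx) c)
    fun hx _ _ h => add_le_add_left (mul_le_mul_of_nonpos_left h hx) c
  curve_injOn t t' ht := by
    rintro ⟨c, x⟩ - ⟨c', x'⟩ - heq
    obtain ⟨h, h'⟩ : x * t + c = x' * t + c' ∧ x * t' + c = x' * t' + c' := Prod.ext_iff.1 heq
    obtain rfl : x = x' := mul_left_cancel₀ (sub_ne_zero.2 ht) (by linear_combination h - h')
    rw [add_left_cancel h]

theorem corollary22_general (A : Finset K) (hA : 2 ≤ #A) :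
    (∃ A₁ ⊆ A, 1 / 4 * (mulEnergy A A : ℝ) ^ (1 / 3 : ℝ) ≤ #A₁ ∧
      (addEnergy A₁ A₁ : ℝ) * mulEnergy A A ≤
        2 ^ 24 * ((#A : ℝ) ^ (11 / 2 : ℝ) * Real.log #A ^ (5 : ℝ))) ∧
    ∃ A₂ ⊆ A, 1 / 4 * (addEnergy A A : ℝ) ^ (1 / 3 : ℝ) ≤ #A₂ ∧
      (mulEnergy A₂ A₂ : ℝ) * addEnergy A A ≤
        2 ^ 24 * ((#A : ℝ) ^ (11 / 2 : ℝ) * Real.log #A ^ (5 : ℝ)) := by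
  have h0 : (0 : K) ∉ A.erase 0 := notMem_erase _ _
  simp only [← opEnergy_mul, ← opEnergy_add]
  exact ⟨exists_subset_rpow_opEnergy_le (hasQuotientOn_mul_div h0) (hasQuotientOn_add_sub _)
      (isCurveModel_mul_sub h0) hA,
    exists_subset_rpow_opEnergy_le (hasQuotientOn_add_sub _) (hasQuotientOn_mul_div h0)
      (isCurveModel_add_div h0) hA⟩

end OrderedField

end Energy

/-- Energies are counted by `Finset.addEnergy` and `Finset.mulEnergy`; `κ` is the implied constant
of `≫`, and `C`, `c` are the implied constant and logarithmic exponent of `≲`. All three are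
absolute: they are chosen before the set `A`. -/
theorem corollary22 :
    ∃ κ C c : ℝ, 0 < κ ∧ 0 < C ∧ 0 < c ∧
      ∀ A : Finset ℝ, 2 ≤ A.card →
        (∃ A₁ : Finset ℝ, A₁ ⊆ A ∧
          κ * (Finset.mulEnergy A A : ℝ) ^ (1 / 3 : ℝ) ≤ (A₁.card : ℝ) ∧
          (Finset.addEnergy A₁ A₁ : ℝ) * (Finset.mulEnergy A A : ℝ) ≤
            C * ((A.card : ℝ) ^ (11 / 2 : ℝ) * Real.log (A.card : ℝ) ^ c)) ∧
        (∃ A₂ : Finset ℝ, A₂ ⊆ A ∧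
          κ * (Finset.addEnergy A A : ℝ) ^ (1 / 3 : ℝ) ≤ (A₂.card : ℝ) ∧
          (Finset.mulEnergy A₂ A₂ : ℝ) * (Finset.addEnergy A A : ℝ) ≤
            C * ((A.card : ℝ) ^ (11 / 2 : ℝ) * Real.log (A.card : ℝ) ^ c)) :=
  ⟨1 / 4, 2 ^ 24, 5, by norm_num, by norm_num, by norm_num, fun A hA => corollary22_general A hA⟩
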